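/- Let $m\ge 2$ and let $\mathcal T$ be the $m$-adic rooted tree, whose vertices are the finite words over $\{1,\dots,m\}$. Let $\operatorname{Aut}\mathcal T$ act on $\mathcal T$ on the right, so that $fg$ means first $f$ and then $g$. Put $\sigma=(1\,2\cdots m)$ and define $a,b\in\operatorname{Aut}\mathcal T$ recursively by $\psi(a)=(1,\dots,1,a)\sigma$ and $\psi(b)=(1,\dots,1,b^{-1})\sigma$; that is, for every letter $x$ and word $w$, $(xw)a=(xw)b=(x+1)w$ if $x<m$, while $(mw)a=1\,(w)a$ and $(mw)b=1\,(w)b^{-1}$. Let $H=\langle a,b\rangle$ be the generalized Brunner-Sidki-Vieira group, $H'=[H,H]$ its commutator subgroup, $\lambda=ab^{-1}$, and, for $n\ge 0$, let $\mathrm{St}_H(n)$ be the subgroup of the elements of $H$ that fix every vertex of level $n$ (so $\mathrm{St}_H(0)=H$). Then the following hold. (i) If $m\ge 3$ is odd, then for every $k\ge 0$ and $1\le j\le m-1$: (P1) $(ab)^{jm^k}\in H'\mathrm{St}_H(2k)\setminus H'\mathrm{St}_H(2k+1)$; (P2) $\lambda^{jm^k}\in H'\mathrm{St}_H(2k+1)\setminus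 H'\mathrm{St}_H(2k+2)$. (ii) If $m\ge 2$ is even, then for every $k\ge 0$: (Q1) $(ab)^{m^{k+1}/2}\in H'\mathrm{St}_H(2k+1)\setminus H'\mathrm{St}_H(2k+2)$; (Q2) $\lambda^{m^{k+1}/2}\in H'\mathrm{St}_H(2k+2)\setminus H'\mathrm{St}_H(2k+3)$. Furthermore, if $m\ge 4$ is even, then for every $k\ge 0$ and every $j$ with $1\le j\le m/2-1$ or $m/2+1\le j\le m-1$: (R1) $(ab)^{jm^k}\in H'\mathrm{St}_H(2k)\setminus H'\mathrm{St}_H(2k+1)$; (R2) $\lambda^{jm^k}\in H'\mathrm{St}_H(2k+1)\setminus H'\mathrm{St}_H(2k+2)$. -/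

import Mathlib

open scoped Pointwise

namespace BSV

/-- The `m`-adic tree: vertices are the finite words over an alphabet with `m` letters (the letter
`i + 1` of the mathematics is `i : Fin m`), and a word `v` is joined to the words `v x`. -/
def adicTree (m : ℕ) : SimpleGraph (List (Fin m)) where
  Adj u v := (∃ x, u = v ++ [x]) ∨ (∃ x, v = u ++ [x])
  symm := ⟨fun _ _ h => h.symm⟩
  loopless := ⟨fun u h => by
    rcases h with ⟨x, hx⟩ | ⟨x, hx⟩ <;> simpa using congrArg List.length hx⟩

/-- The group of graph automorphisms of the `m`-adic tree. Automorphisms act on the right, so a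
product `f * g` means "first `f`, then `g`"; as the product of graph isomorphisms in Mathlib is the
composition of functions, this is the opposite group. -/
abbrev AutTree (m : ℕ) : Type := (adicTree m ≃g adicTree m)ᵐᵒᵖ

/-- The image `(v)g` of the vertex `v` under the automorphism `g`. -/
def act {m : ℕ} (v : List (Fin m)) (g : AutTree m) : List (Fin m) := g.unop v

theorem act_one {m : ℕ} (v : List (Fin m)) : act v (1 : AutTree m) = v := rfl

theorem act_mul {m : ℕ} (v : List (Fin m)) (f g : AutTree m) :
    act v (f * g) = act (act v f) g := rfl

/-- The `n`th level stabilizer `St(n)` (all of the group when `n = 0`). -/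
def levelStab (m n : ℕ) : Subgroup (AutTree m) where
  carrier := {g | ∀ v : List (Fin m), v.length = n → act v g = v}
  one_mem' := fun _ _ => rfl
  mul_mem' := fun {f g} hf hg v hv => by rw [act_mul, hf v hv, hg v hv]
  inv_mem' := fun {g} hg v hv => by
    have h := congrArg (fun w => act w g⁻¹) (hg v hv)
    simp only [← act_mul, mul_inv_cancel, act_one] at h
    exact h.symm

/-- The action of `a` on words: `a` applies the cycle `σ = (1 2 ⋯ m)` to the first letter, and
its section is `a` at the letter `m` and trivial at the other letters. -/
def aFun (m : ℕ) : List (Fin m) → List (Fin m)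
  | [] => []
  | x :: w => finRotate m x :: (if (x : ℕ) + 1 = m then aFun m w else w)

/-- The inverse of `aFun`. -/
def aInvFun (m : ℕ) : List (Fin m) → List (Fin m)
  | [] => []
  | x :: w => (finRotate m).symm x ::
      (if ((finRotate m).symm x : ℕ) + 1 = m then aInvFun m w else w)

/-- The action of `b` (for `true`) and of `b⁻¹` (for `false`) on words: `b` applies `σ` to the
first letter, and its section is `b⁻¹` at the letter `m` and trivial at the other letters;
accordingly `b⁻¹` applies `σ⁻¹` to the first letter, and its section is `b` at the letter `1`
(the letter that `σ⁻¹` sends to `m`) and trivial at the other letters. -/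
def bFun (m : ℕ) : Bool → List (Fin m) → List (Fin m)
  | _, [] => []
  | true, x :: w => finRotate m x :: (if (x : ℕ) + 1 = m then bFun m false w else w)
  | false, x :: w => (finRotate m).symm x ::
      (if ((finRotate m).symm x : ℕ) + 1 = m then bFun m true w else w)

theorem aInvFun_aFun (m : ℕ) (w : List (Fin m)) : aInvFun m (aFun m w) = w := by
  induction w with
  | nil => rfl
  | cons x w ih =>
    by_cases h : (x : ℕ) + 1 = m <;>
      simp only [aFun, aInvFun, Equiv.symm_apply_apply, Equiv.apply_symm_apply, h, if_true,
        if_false, ih]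

theorem aFun_aInvFun (m : ℕ) (w : List (Fin m)) : aFun m (aInvFun m w) = w := by
  induction w with
  | nil => rfl
  | cons x w ih =>
    by_cases h : ((finRotate m).symm x : ℕ) + 1 = m <;>
      simp only [aFun, aInvFun, Equiv.symm_apply_apply, Equiv.apply_symm_apply, h, if_true,
        if_false, ih]

theorem bFun_bFun (m : ℕ) (s : Bool) (w : List (Fin m)) : bFun m (!s) (bFun m s w) = w := by
  induction w generalizing s with
  | nil => cases s <;> rfl
  | cons x w ih =>
    have h1 := ih true
    have h2 := ih false
    simp only [Bool.not_true, Bool.not_false] at h1 h2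
    cases s
    · by_cases h : ((finRotate m).symm x : ℕ) + 1 = m <;>
        simp only [bFun, Bool.not_false, Equiv.apply_symm_apply, h, if_true, if_false, h1]
    · by_cases h : (x : ℕ) + 1 = m <;>
        simp only [bFun, Bool.not_true, Equiv.symm_apply_apply, h, if_true, if_false, h2]

theorem aFun_append (m : ℕ) (v : List (Fin m)) (x : Fin m) :
    ∃ y, aFun m (v ++ [x]) = aFun m v ++ [y] := by
  induction v with
  | nil => exact ⟨finRotate m x, by simp [aFun]⟩
  | cons z v ih =>
    obtain ⟨y, hy⟩ := ih
    by_cases h : (z : ℕ) + 1 = m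
    · exact ⟨y, by simp [aFun, h, hy]⟩
    · exact ⟨x, by simp [aFun, h]⟩

theorem aInvFun_append (m : ℕ) (v : List (Fin m)) (x : Fin m) :
    ∃ y, aInvFun m (v ++ [x]) = aInvFun m v ++ [y] := by
  induction v with
  | nil => exact ⟨(finRotate m).symm x, by simp [aInvFun]⟩
  | cons z v ih =>
    obtain ⟨y, hy⟩ := ih
    by_cases h : ((finRotate m).symm z : ℕ) + 1 = m
    · exact ⟨y, by simp only [List.cons_append, aInvFun, h, if_true, hy]⟩
    · exact ⟨x, by simp only [List.cons_append, aInvFun, h, if_false]⟩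

theorem bFun_append (m : ℕ) (s : Bool) (v : List (Fin m)) (x : Fin m) :
    ∃ y, bFun m s (v ++ [x]) = bFun m s v ++ [y] := by
  induction v generalizing s with
  | nil => cases s <;> simp [bFun]
  | cons z v ih =>
    cases s
    · obtain ⟨y, hy⟩ := ih true
      by_cases h : ((finRotate m).symm z : ℕ) + 1 = m
      · exact ⟨y, by simp only [List.cons_append, bFun, h, if_true, hy]⟩
      · exact ⟨x, by simp only [List.cons_append, bFun, h, if_false]⟩
    · obtain ⟨y, hy⟩ := ih false
      by_cases h : (z : ℕ) + 1 = m
      · exact ⟨y, by simp only [List.cons_append, bFun, h, if_true, hy]⟩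
      · exact ⟨x, by simp only [List.cons_append, bFun, h, if_false]⟩

theorem adj_of_append {m : ℕ} {f : List (Fin m) → List (Fin m)}
    (hf : ∀ v x, ∃ y, f (v ++ [x]) = f v ++ [y]) {u v : List (Fin m)}
    (h : (adicTree m).Adj u v) : (adicTree m).Adj (f u) (f v) := by
  rcases h with ⟨x, rfl⟩ | ⟨x, rfl⟩
  · exact Or.inl (hf v x)
  · exact Or.inr (hf u x)

/-- A bijection of the words which, like its inverse, respects the relation "below" is an
automorphism of the tree. -/
def autOfFun {m : ℕ} (f g : List (Fin m) → List (Fin m)) (hgf : ∀ v, g (f v) = v)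
    (hfg : ∀ v, f (g v) = v) (hf : ∀ v x, ∃ y, f (v ++ [x]) = f v ++ [y])
    (hg : ∀ v x, ∃ y, g (v ++ [x]) = g v ++ [y]) : AutTree m :=
  MulOpposite.op
    { toFun := f
      invFun := g
      left_inv := hgf
      right_inv := hfg
      map_rel_iff' := fun {u v} =>
        ⟨fun h => by
          have h' := adj_of_append hg h
          simpa [hgf] using h', fun h => adj_of_append hf h⟩ }

/-- The automorphism `a` with `ψ(a) = (1, …, 1, a)σ`. -/
def a (m : ℕ) : AutTree m :=
  autOfFun (aFun m) (aInvFun m) (aInvFun_aFun m) (aFun_aInvFun m) (aFun_append m)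
    (aInvFun_append m)

/-- The automorphism `b` with `ψ(b) = (1, …, 1, b⁻¹)σ`. -/
def b (m : ℕ) : AutTree m :=
  autOfFun (bFun m true) (bFun m false) (bFun_bFun m true) (bFun_bFun m false)
    (bFun_append m true) (bFun_append m false)

/-- The recursion `ψ(a) = (1, …, 1, a)σ`. -/
theorem act_a_cons (m : ℕ) (x : Fin m) (w : List (Fin m)) :
    act (x :: w) (a m) = finRotate m x :: (if (x : ℕ) + 1 = m then act w (a m) else w) := rfl

/-- The recursion `ψ(b) = (1, …, 1, b⁻¹)σ`. -/
theorem act_b_cons (m : ℕ) (x : Fin m) (w : List (Fin m)) :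
    act (x :: w) (b m) = finRotate m x :: (if (x : ℕ) + 1 = m then act w (b m)⁻¹ else w) := rfl

/-- The element `λ = a b⁻¹`. -/
def lam (m : ℕ) : AutTree m := a m * (b m)⁻¹

/-- The generalized Brunner-Sidki-Vieira group `H`, generated by `a` and `b`. -/
def H (m : ℕ) : Subgroup (AutTree m) := Subgroup.closure {a m, b m}

/-- The level stabilizer `St_H(n) = St(n) ∩ H`. -/
def St (m n : ℕ) : Subgroup (AutTree m) := levelStab m n ⊓ H m

/-- The product `H' St_H(n)` of the commutator subgroup of `H` and the level stabilizer. -/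
def commSt (m n : ℕ) : Set (AutTree m) :=
  ((⁅H m, H m⁆ : Subgroup (AutTree m)) : Set (AutTree m)) * (St m n : Set (AutTree m))

end BSV

/-! Whether the value of a word lies in H'St_H(n) depends only on its exponent sums (i, j) in a and
b: it does exactly when some word with the same sums fixes level n (`eval_mem_commSt_iff`). For each
n these pairs form a subgroup Λ_n of ℤ², and everything reduces to computing it.

The recursion is `trivialExp_succ_iff`: (i, j) ∈ Λ_{n+1} iff i + j = mt for some t such that (i, -j)
∈ Λ_n and (t + s, s) ∈ Λ_n for some s. It is necessary because the exponents of the m sections of a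
word add up to (i, -j) and each section has exponent difference t. It is sufficient because a^m, b^m
and λ realize enough tuples of sections.

By induction Λ_n is cut out by one modulus for i + j and one for i - j. Passing up a level, the old
sum modulus becomes the difference modulus, and m times the old difference modulus becomes the sum
modulus. For odd m the moduli start as (1, 1) at level 0. For even m they start as (m, 2) at level
1, since m ∣ i + j makes i - j even. Finally (ab)^e has sum 2e and difference 0, λ^e has sum 0 and
difference 2e, so each claim is a divisibility of 2e. -/

namespace BSV

/-! ### Words and their exponent sums -/

/-- The free group on two letters: `true` stands for `a`, `false` for `b`. -/
abbrev Word : Type := FreeGroup Bool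

/-- The evaluation of words in `a` and `b` in the automorphism group of the tree. -/
def eval (m : ℕ) : Word →* AutTree m :=
  FreeGroup.lift fun c => if c then a m else b m

/-- The exponent sum of the letter `c` as a homomorphism. -/
def expHom (c : Bool) : Word →* Multiplicative ℤ :=
  FreeGroup.lift fun d => Multiplicative.ofAdd (if d = c then 1 else 0)

/-- The exponent sum of the letter `c` in a word. -/
def expSum (c : Bool) (W : Word) : ℤ := Multiplicative.toAdd (expHom c W)

theorem expSum_one (c : Bool) : expSum c 1 = 0 := by simp [expSum]

theorem expSum_mul (c : Bool) (V W : Word) : expSum c (V * W) = expSum c V + expSum c W := by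
  simp [expSum]

theorem expSum_inv (c : Bool) (W : Word) : expSum c W⁻¹ = -expSum c W := by
  simp [expSum]

theorem expSum_pow (c : Bool) (W : Word) (n : ℕ) : expSum c (W ^ n) = n * expSum c W := by
  simp [expSum]

theorem expSum_of (c d : Bool) : expSum c (FreeGroup.of d) = if d = c then 1 else 0 := by
  simp [expSum, expHom]

theorem eval_true (m : ℕ) : eval m (FreeGroup.of true) = a m := by simp [eval]

theorem eval_false (m : ℕ) : eval m (FreeGroup.of false) = b m := by simp [eval]

theorem range_eval (m : ℕ) : (eval m).range = H m := by
  rw [eval, FreeGroup.range_lift_eq_closure, H]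
  congr 1
  ext g
  simp [or_comm]

theorem eval_mem_H (m : ℕ) (W : Word) : eval m W ∈ H m :=
  range_eval m ▸ ⟨W, rfl⟩

/-- Modulo commutators a word is determined by its exponent sums. -/
theorem abelianization_of_word (W : Word) :
    Abelianization.of W =
      Abelianization.of (FreeGroup.of true) ^ expSum true W *
        Abelianization.of (FreeGroup.of false) ^ expSum false W := by
  induction W using FreeGroup.induction_on with
  | C1 => simp [expSum_one]
  | of c => cases c <;> simp [expSum_of]
  | inv_of c ih => rw [map_inv, ih, expSum_inv, expSum_inv, zpow_neg, zpow_neg, mul_inv]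
  | mul V W hV hW =>
    rw [map_mul, hV, hW, expSum_mul, expSum_mul, zpow_add, zpow_add, mul_mul_mul_comm]

theorem mem_commutator_of_expSum_eq_zero {W : Word} (h : ∀ c, expSum c W = 0) :
    W ∈ commutator Word := by
  have := abelianization_of_word W
  rw [h, h, zpow_zero, zpow_zero, mul_one] at this
  rwa [← Abelianization.ker_of]

theorem expSum_eq_zero_of_mem_commutator {W : Word} (h : W ∈ commutator Word) (c : Bool) :
    expSum c W = 0 := by
  have : expHom c W = 1 := Abelianization.commutator_subset_ker (expHom c) h
  simp [expSum, this]

theorem map_eval_commutator (m : ℕ) : (commutator Word).map (eval m) = ⁅H m, H m⁆ := by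
  rw [commutator_def, Subgroup.map_commutator, ← MonoidHom.range_eq_map, range_eval]

/-! ### Exponent pairs of words fixing a level -/

/-- The pair `(i, j)` is the pair of exponent sums of a word in `a` and `b` that fixes every vertex
of level `n`. -/
def TrivialExp (m n : ℕ) (i j : ℤ) : Prop :=
  ∃ W : Word, eval m W ∈ levelStab m n ∧ expSum true W = i ∧ expSum false W = j

theorem TrivialExp.add {m n : ℕ} {i j i' j' : ℤ} (h : TrivialExp m n i j)
    (h' : TrivialExp m n i' j') : TrivialExp m n (i + i') (j + j') := by
  obtain ⟨V, hV, rfl, rfl⟩ := h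
  obtain ⟨W, hW, rfl, rfl⟩ := h'
  exact ⟨V * W, by rw [map_mul]; exact mul_mem hV hW, expSum_mul _ _ _, expSum_mul _ _ _⟩

theorem TrivialExp.neg {m n : ℕ} {i j : ℤ} (h : TrivialExp m n i j) :
    TrivialExp m n (-i) (-j) := by
  obtain ⟨V, hV, rfl, rfl⟩ := h
  exact ⟨V⁻¹, by rw [map_inv]; exact inv_mem hV, expSum_inv _ _, expSum_inv _ _⟩

theorem TrivialExp.zero (m n : ℕ) : TrivialExp m n 0 0 :=
  ⟨1, by rw [map_one]; exact one_mem _, expSum_one _, expSum_one _⟩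

theorem TrivialExp.nsmul {m n : ℕ} {i j : ℤ} (h : TrivialExp m n i j) (r : ℕ) :
    TrivialExp m n (r * i) (r * j) := by
  obtain ⟨V, hV, rfl, rfl⟩ := h
  exact ⟨V ^ r, by rw [map_pow]; exact pow_mem hV r, expSum_pow _ _ _, expSum_pow _ _ _⟩

theorem TrivialExp.sum {m n : ℕ} {ι : Type*} (s : Finset ι) {f g : ι → ℤ}
    (h : ∀ x ∈ s, TrivialExp m n (f x) (g x)) :
    TrivialExp m n (∑ x ∈ s, f x) (∑ x ∈ s, g x) := by
  classical
  induction s using Finset.induction_on with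
  | empty => simpa using TrivialExp.zero m n
  | insert x s hx ih =>
    rw [Finset.sum_insert hx, Finset.sum_insert hx]
    exact (h x (Finset.mem_insert_self x s)).add
      (ih fun y hy => h y (Finset.mem_insert_of_mem hy))

/-- H' is the image of the commutator subgroup of the free group, which consists of the words with
zero exponent sums. Hence relations of H play no role, and exponent sums need not be well defined on
H. -/
theorem eval_mem_commSt_iff (m n : ℕ) (W : Word) :
    eval m W ∈ commSt m n ↔ TrivialExp m n (expSum true W) (expSum false W) := by
  constructor
  · rintro ⟨c, hc, s, hs, hcs⟩
    rw [SetLike.mem_coe, ← map_eval_commutator] at hc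
    obtain ⟨C, hC, rfl⟩ := hc
    refine ⟨C⁻¹ * W, ?_, ?_, ?_⟩
    · rw [map_mul, map_inv, ← hcs]
      simpa using hs.1
    all_goals rw [expSum_mul, expSum_inv, expSum_eq_zero_of_mem_commutator hC, neg_zero, zero_add]
  · rintro ⟨V, hV, hA, hB⟩
    refine ⟨eval m (W * V⁻¹), ?_, eval m V, ⟨hV, eval_mem_H m V⟩, ?_⟩
    · rw [SetLike.mem_coe, ← map_eval_commutator]
      refine ⟨_, mem_commutator_of_expSum_eq_zero fun c => ?_, rfl⟩
      cases c <;> simp [expSum_mul, expSum_inv, hA, hB]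
    · simp

/-- Level zero imposes no condition. -/
theorem trivialExp_level_zero (m : ℕ) (i j : ℤ) : TrivialExp m 0 i j := by
  have key : ∀ W, eval m W ∈ levelStab m 0 := by
    intro W
    induction W using FreeGroup.induction_on with
    | C1 => rw [map_one]; exact one_mem _
    | of c =>
      intro v hv
      rw [List.length_eq_zero_iff] at hv
      subst hv
      cases c
      · rw [eval_false]; rfl
      · rw [eval_true]; rfl
    | inv_of c ih => rw [map_inv]; exact inv_mem ih
    | mul V W hV hW => rw [map_mul]; exact mul_mem hV hW
  refine ⟨FreeGroup.of true ^ i * FreeGroup.of false ^ j, key _, ?_, ?_⟩ <;>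
    simp [expSum, expHom]

/-! ### Sections of a word: necessity of the recursion -/

/-- The first-level decomposition of a word: `p` is the permutation of the letters and `s` lists the
sections. -/
structure Decomp (m : ℕ) (W : Word) (p : Equiv.Perm (Fin m)) (s : Fin m → Word) : Prop where
  act_cons : ∀ x v, act (x :: v) (eval m W) = p x :: act v (eval m (s x))
  sum_true : ∑ x, expSum true (s x) = expSum true W
  sum_false : ∑ x, expSum false (s x) = -expSum false W
  -- Both generators advance the first letter by one. Each passage from the last letter to the first
  -- adds a or b⁻¹ to the section, so the exponent difference of the section counts the turns.
  wrap : ∀ x : Fin m, (x : ℤ) + expSum true W + expSum false W =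
    p x + m * (expSum true (s x) - expSum false (s x))

theorem Decomp.one (m : ℕ) : Decomp m 1 1 1 where
  act_cons x v := by simp [act_one]
  sum_true := by simp [expSum_one]
  sum_false := by simp [expSum_one]
  wrap x := by simp [expSum_one]

theorem Decomp.mul {m : ℕ} {V W : Word} {p q : Equiv.Perm (Fin m)} {s t : Fin m → Word}
    (hV : Decomp m V p s) (hW : Decomp m W q t) :
    Decomp m (V * W) (p.trans q) fun x => s x * t (p x) where
  act_cons x v := by
    rw [map_mul, act_mul, hV.act_cons, hW.act_cons, map_mul, act_mul]; rfl
  sum_true := by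
    simp only [expSum_mul, Finset.sum_add_distrib, hV.sum_true]
    rw [Equiv.sum_comp p (fun x => expSum true (t x)), hW.sum_true]
  sum_false := by
    simp only [expSum_mul, Finset.sum_add_distrib, hV.sum_false]
    rw [Equiv.sum_comp p (fun x => expSum false (t x)), hW.sum_false]
    ring
  wrap x := by
    have h1 := hV.wrap x
    have h2 := hW.wrap (p x)
    simp only [expSum_mul, Equiv.trans_apply]
    linear_combination h1 + h2

theorem Decomp.inv {m : ℕ} {W : Word} {p : Equiv.Perm (Fin m)} {s : Fin m → Word}
    (h : Decomp m W p s) : Decomp m W⁻¹ p.symm fun x => (s (p.symm x))⁻¹ where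
  act_cons x v := by
    have h1 := h.act_cons (p.symm x) (act v (eval m (s (p.symm x)))⁻¹)
    rw [← act_mul, inv_mul_cancel, act_one, Equiv.apply_symm_apply] at h1
    rw [map_inv, map_inv, ← h1, ← act_mul, mul_inv_cancel, act_one]
  sum_true := by
    simp only [expSum_inv, Finset.sum_neg_distrib]
    rw [Equiv.sum_comp p.symm (fun x => expSum true (s x)), h.sum_true]
  sum_false := by
    simp only [expSum_inv, Finset.sum_neg_distrib]
    rw [Equiv.sum_comp p.symm (fun x => expSum false (s x)), h.sum_false]
  wrap x := by
    have h1 := h.wrap (p.symm x)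
    rw [Equiv.apply_symm_apply] at h1
    simp only [expSum_inv]
    linear_combination -h1

theorem finRotate_wrap {m : ℕ} (x : Fin m) :
    (x : ℤ) + 1 = finRotate m x + m * (if (x : ℕ) + 1 = m then 1 else 0) := by
  obtain _ | m := m
  · exact x.elim0
  split_ifs with h
  · have : x = Fin.last m := Fin.ext (by simpa using h)
    subst this
    simp
  · rw [coe_finRotate_of_ne_last (fun hx => h (by rw [hx]; simp))]
    simp

theorem sum_ite_last {m : ℕ} (hm : 2 ≤ m) (c : ℤ) :
    ∑ x : Fin m, (if (x : ℕ) + 1 = m then c else 0) = c := by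
  rw [Finset.sum_eq_single ⟨m - 1, by omega⟩]
  · rw [if_pos (by simp only; omega)]
  · intro x _ hx
    rw [if_neg]
    intro h
    exact hx (Fin.ext (by simp only; omega))
  · simp

theorem decomp_a {m : ℕ} (hm : 2 ≤ m) :
    Decomp m (FreeGroup.of true) (finRotate m)
      fun x => if (x : ℕ) + 1 = m then FreeGroup.of true else 1 where
  act_cons x v := by
    rw [eval_true, act_a_cons]
    split_ifs
    · rw [eval_true]
    · rw [map_one, act_one]
  sum_true := by simp [apply_ite, expSum_of, expSum_one, sum_ite_last hm]
  sum_false := by simp [apply_ite, expSum_of, expSum_one]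
  wrap x := by
    have := finRotate_wrap x
    simp [apply_ite, expSum_of, expSum_one] at this ⊢
    exact this

theorem decomp_b {m : ℕ} (hm : 2 ≤ m) :
    Decomp m (FreeGroup.of false) (finRotate m)
      fun x => if (x : ℕ) + 1 = m then (FreeGroup.of false)⁻¹ else 1 where
  act_cons x v := by
    rw [eval_false, act_b_cons]
    split_ifs
    · rw [map_inv, eval_false]
    · rw [map_one, act_one]
  sum_true := by simp [apply_ite, expSum_of, expSum_one, expSum_inv]
  sum_false := by simp [apply_ite, expSum_of, expSum_one, expSum_inv, sum_ite_last hm]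
  wrap x := by
    have := finRotate_wrap x
    simp only [apply_ite (expSum _), expSum_of, expSum_one, expSum_inv]
    split_ifs at this ⊢ <;> simp_all

theorem exists_decomp {m : ℕ} (hm : 2 ≤ m) (W : Word) : ∃ p s, Decomp m W p s := by
  induction W using FreeGroup.induction_on with
  | C1 => exact ⟨_, _, Decomp.one m⟩
  | of c =>
    cases c
    · exact ⟨_, _, decomp_b hm⟩
    · exact ⟨_, _, decomp_a hm⟩
  | inv_of c ih =>
    obtain ⟨p, s, h⟩ := ih
    exact ⟨_, _, h.inv⟩
  | mul V W hV hW =>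
    obtain ⟨p, s, h⟩ := hV
    obtain ⟨q, t, h'⟩ := hW
    exact ⟨_, _, h.mul h'⟩

/-- All sections of a word fixing level n + 1 fix level n. Their product gives the pair (i, -j); the
single section at the first letter gives (t + s, s), where t is its number of turns. -/
theorem TrivialExp.of_succ {m : ℕ} (hm : 2 ≤ m) {n : ℕ} {i j : ℤ}
    (h : TrivialExp m (n + 1) i j) :
    ∃ t, i + j = m * t ∧ TrivialExp m n i (-j) ∧ ∃ s, TrivialExp m n (t + s) s := by
  obtain ⟨W, hW, rfl, rfl⟩ := h
  obtain ⟨p, s, hd⟩ := exists_decomp hm W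
  have key : ∀ x v, v.length = n → p x = x ∧ act v (eval m (s x)) = v := by
    intro x v hv
    have h1 := hW (x :: v) (by simp [hv])
    rw [hd.act_cons] at h1
    exact List.cons_eq_cons.1 h1
  have hs : ∀ x, TrivialExp m n (expSum true (s x)) (expSum false (s x)) :=
    fun x => ⟨s x, fun v hv => (key x v hv).2, rfl, rfl⟩
  let z : Fin m := ⟨0, by omega⟩
  refine ⟨expSum true (s z) - expSum false (s z), ?_, ?_, expSum false (s z), ?_⟩
  · have h1 := hd.wrap z
    rw [(key z (List.replicate n z) (by simp)).1] at h1
    linear_combination h1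
  · rw [← hd.sum_true, ← hd.sum_false]
    exact TrivialExp.sum _ fun x _ => hs x
  · simpa using hs z

/-! ### Words with prescribed sections: sufficiency of the recursion -/

/-- `g` fixes the first level and has the sections `s x`. -/
def HasSections {m : ℕ} (g : AutTree m) (s : Fin m → AutTree m) : Prop :=
  ∀ x v, act (x :: v) g = x :: act v (s x)

theorem HasSections.one (m : ℕ) : HasSections (1 : AutTree m) 1 := fun _ _ => rfl

theorem HasSections.mul {m : ℕ} {g h : AutTree m} {s t : Fin m → AutTree m}
    (hg : HasSections g s) (hh : HasSections h t) : HasSections (g * h) (s * t) := fun x v => by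
  rw [act_mul, hg, hh, Pi.mul_apply, act_mul]

theorem HasSections.inv {m : ℕ} {g : AutTree m} {s : Fin m → AutTree m}
    (hg : HasSections g s) : HasSections g⁻¹ s⁻¹ := fun x v => by
  have h1 := hg x (act v (s x)⁻¹)
  rw [← act_mul, inv_mul_cancel, act_one] at h1
  rw [Pi.inv_apply, ← h1, ← act_mul, mul_inv_cancel, act_one]

/-- Sections of values of a homomorphism can be checked on generators. -/
theorem hasSections_lift {m : ℕ} {f : Word →* AutTree m} {s : Word →* (Fin m → AutTree m)}
    (h : ∀ c, HasSections (f (FreeGroup.of c)) (s (FreeGroup.of c))) (W : Word) :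
    HasSections (f W) (s W) := by
  induction W using FreeGroup.induction_on with
  | C1 => rw [map_one, map_one]; exact HasSections.one m
  | of c => exact h c
  | inv_of c ih => rw [map_inv, map_inv]; exact ih.inv
  | mul V W hV hW => rw [map_mul, map_mul]; exact hV.mul hW

/-- If `g` rotates the first letter and has the section `h` at the last letter and trivial sections
elsewhere, then `g ^ m` has the section `h` everywhere. -/
theorem hasSections_pow {m : ℕ} {g h : AutTree m}
    (hg : ∀ x v, act (x :: v) g =
      finRotate m x :: (if (x : ℕ) + 1 = m then act v h else v)) :
    HasSections (g ^ m) fun _ => h := by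
  intro x v
  have up : ∀ (r : ℕ) (y z : Fin m) (w : List (Fin m)), (y : ℕ) + r = z →
      act (y :: w) (g ^ r) = z :: w := by
    intro r
    induction r with
    | zero =>
      intro y z w hz
      obtain rfl : y = z := Fin.ext (by simpa using hz)
      rw [pow_zero, act_one]
    | succ r ih =>
      intro y z w hz
      have hy : ¬ (y : ℕ) + 1 = m := by omega
      rw [pow_succ', act_mul, hg, if_neg hy]
      refine ih _ _ _ ?_
      have := finRotate_wrap y
      rw [if_neg hy] at this
      omega
  have hx := x.isLt
  let l : Fin m := ⟨m - 1, by omega⟩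
  have hl : ((l : Fin m) : ℕ) + 1 = m := by simp only [l]; omega
  -- The factors are the moves up to the last letter, the one move that wraps around, and the moves
  -- back up to x; only the wrap contributes a section.
  have e : g ^ m = g ^ (m - 1 - (x : ℕ)) * (g * g ^ (x : ℕ)) := by
    rw [← pow_succ', ← pow_add]
    congr 1
    omega
  rw [e, act_mul, up _ x l v (by simp only [l]; omega), act_mul, hg, if_pos hl]
  refine up _ _ _ _ ?_
  have := finRotate_wrap l
  rw [if_pos hl] at this
  omega

theorem hasSections_a_pow (m : ℕ) : HasSections (a m ^ m) fun _ => a m :=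
  hasSections_pow (act_a_cons m)

theorem hasSections_b_pow (m : ℕ) : HasSections (b m ^ m) fun _ => (b m)⁻¹ :=
  hasSections_pow (act_b_cons m)

theorem hasSections_lam (m : ℕ) :
    HasSections (lam m) fun x => if (x : ℕ) + 1 = m then a m * b m else 1 := by
  intro x v
  -- Comparing a with b applied to the claimed image avoids computing b⁻¹ on words; at the last
  -- letter, ab followed by the section b⁻¹ is a.
  have h1 : act (x :: act v (if (x : ℕ) + 1 = m then a m * b m else 1)) (b m) =
      act (x :: v) (a m) := by
    rw [act_a_cons, act_b_cons]
    split_ifs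
    · rw [← act_mul, mul_inv_cancel_right]
    · rw [act_one]
  rw [lam, act_mul, ← h1, ← act_mul, mul_inv_cancel, act_one]

/-- The endomorphism `D` of the free group with `D W = (W, …, W)`. -/
def diagHom (m : ℕ) : Word →* Word :=
  FreeGroup.lift fun c => if c then FreeGroup.of true ^ m else (FreeGroup.of false ^ m)⁻¹

theorem hasSections_diagHom (m : ℕ) (W : Word) :
    HasSections (eval m (diagHom m W)) fun _ => eval m W := by
  refine hasSections_lift (f := (eval m).comp (diagHom m))
    (s := MonoidHom.mk' (fun W _ => eval m W) fun V W => by funext x; simp) ?_ W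
  intro c
  cases c
  · have := (hasSections_b_pow m).inv
    rw [Pi.inv_def] at this
    simpa [diagHom, eval_false] using this
  · simpa [diagHom, eval_true] using hasSections_a_pow m

theorem expSum_diagHom (m : ℕ) (W : Word) :
    expSum true (diagHom m W) = m * expSum true W ∧
      expSum false (diagHom m W) = -(m * expSum false W) := by
  induction W using FreeGroup.induction_on with
  | C1 => simp [expSum_one]
  | of c => cases c <;> simp [diagHom, expSum_pow, expSum_inv, expSum_of]
  | inv_of c ih =>
    rw [map_inv, expSum_inv, expSum_inv, expSum_inv, expSum_inv, ih.1, ih.2]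
    constructor <;> ring
  | mul V W hV hW =>
    simp only [map_mul, expSum_mul, hV.1, hV.2, hW.1, hW.2]; constructor <;> ring

/-- The endomorphism `L` of the free group with `L W = (a ^ e, …, a ^ e, W)`, where `e` is the
difference of the exponent sums of `W`. -/
def lastHom (m : ℕ) : Word →* Word :=
  FreeGroup.lift fun c => if c then FreeGroup.of true ^ m
    else (FreeGroup.of true ^ m)⁻¹ * (FreeGroup.of true * (FreeGroup.of false)⁻¹)

/-- Since a^m = (a, …, a) and λ = (1, …, 1, ab), the element a^{-m}λ is (a⁻¹, …, a⁻¹, b). -/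
theorem hasSections_lastHom (m : ℕ) (W : Word) :
    HasSections (eval m (lastHom m W)) fun x =>
      if (x : ℕ) + 1 = m then eval m W else a m ^ (expSum true W - expSum false W) := by
  refine hasSections_lift (f := (eval m).comp (lastHom m))
    (s := MonoidHom.mk' (fun W x => if (x : ℕ) + 1 = m then eval m W
      else a m ^ (expSum true W - expSum false W)) fun V W => ?_) ?_ W
  · funext x
    simp only [Pi.mul_apply]
    split_ifs
    · simp
    · rw [← zpow_add, expSum_mul, expSum_mul]
      congr 1
      ring
  · intro c
    cases c
    · have h := (hasSections_a_pow m).inv.mul (hasSections_lam m)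
      rw [lam] at h
      simp only [MonoidHom.comp_apply, lastHom, FreeGroup.lift_apply_of, Bool.false_eq_true,
        if_false, map_mul, map_inv, map_pow, eval_true, eval_false, MonoidHom.mk'_apply]
      convert h using 1
      funext x
      simp only [Pi.mul_apply, Pi.inv_apply]
      split_ifs <;> simp [expSum_of]
    · simp only [MonoidHom.comp_apply, lastHom, FreeGroup.lift_apply_of,
        if_true, map_pow, eval_true, MonoidHom.mk'_apply]
      convert hasSections_a_pow m using 1
      funext x
      split_ifs <;> simp [expSum_of]

theorem expSum_lastHom (m : ℕ) (W : Word) :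
    expSum true (lastHom m W) =
        m * (expSum true W - expSum false W) + expSum false W ∧
      expSum false (lastHom m W) = -expSum false W := by
  induction W using FreeGroup.induction_on with
  | C1 => simp [expSum_one]
  | of c => cases c <;> simp [lastHom, expSum_mul, expSum_pow, expSum_inv, expSum_of]
  | inv_of c ih =>
    rw [map_inv, expSum_inv, expSum_inv, expSum_inv, expSum_inv, ih.1, ih.2]
    constructor <;> ring
  | mul V W hV hW =>
    simp only [map_mul, expSum_mul, hV.1, hV.2, hW.1, hW.2]; constructor <;> ring

theorem HasSections.mem_levelStab {m n : ℕ} {g : AutTree m} {s : Fin m → AutTree m}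
    (hg : HasSections g s) (hs : ∀ x, s x ∈ levelStab m n) : g ∈ levelStab m (n + 1) := by
  intro v hv
  obtain _ | ⟨x, v⟩ := v
  · simp at hv
  · rw [hg, hs x v (by simpa using hv)]

/-- A word W with pair (t + s, s) is placed at every letter by `diagHom`. What remains of (i, -j)
after removing m copies has exponent difference i + j - mt = 0, so a word V with that pair can be
placed at the last letter alone by `lastHom`. -/
theorem TrivialExp.succ {m n : ℕ} {i j s t : ℤ} (hij : i + j = m * t)
    (h : TrivialExp m n i (-j)) (hs : TrivialExp m n (t + s) s) : TrivialExp m (n + 1) i j := by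
  obtain ⟨V, hV, hV1, hV2⟩ := h.add (hs.nsmul m).neg
  obtain ⟨W, hW, hW1, hW2⟩ := hs
  have hVd : expSum true V - expSum false V = 0 := by
    rw [hV1, hV2]
    linear_combination hij
  refine ⟨diagHom m W * lastHom m V, ?_, ?_, ?_⟩
  · rw [map_mul]
    refine mul_mem ((hasSections_diagHom m W).mem_levelStab fun _ => hW)
      ((hasSections_lastHom m V).mem_levelStab fun x => ?_)
    split_ifs
    · exact hV
    · rw [hVd, zpow_zero]
      exact one_mem _
  · rw [expSum_mul, (expSum_diagHom m W).1, (expSum_lastHom m V).1, hVd, hW1, hV2]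
    linear_combination -hij
  · rw [expSum_mul, (expSum_diagHom m W).2, (expSum_lastHom m V).2, hW2, hV2]
    ring

/-! ### Solving the recursion -/

theorem trivialExp_succ_iff {m : ℕ} (hm : 2 ≤ m) (n : ℕ) (i j : ℤ) :
    TrivialExp m (n + 1) i j ↔
      ∃ t, i + j = m * t ∧ TrivialExp m n i (-j) ∧ ∃ s, TrivialExp m n (t + s) s :=
  ⟨TrivialExp.of_succ hm, fun ⟨_, hij, h, _, hs⟩ => TrivialExp.succ hij h hs⟩

theorem trivialExp_one_iff {m : ℕ} (hm : 2 ≤ m) (i j : ℤ) :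
    TrivialExp m 1 i j ↔ (m : ℤ) ∣ i + j := by
  rw [trivialExp_succ_iff hm]
  exact ⟨fun ⟨t, ht, _⟩ => ⟨t, ht⟩, fun ⟨t, ht⟩ =>
    ⟨t, ht, trivialExp_level_zero _ _ _, 0, trivialExp_level_zero _ _ _⟩⟩

theorem trivialExp_iff_of_odd {m : ℕ} (hm : 2 ≤ m) (ho : Odd m) (k : ℕ) :
    (∀ i j, TrivialExp m (2 * k) i j ↔ (m : ℤ) ^ k ∣ i + j ∧ (m : ℤ) ^ k ∣ i - j) ∧
      ∀ i j, TrivialExp m (2 * k + 1) i j ↔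
        (m : ℤ) ^ (k + 1) ∣ i + j ∧ (m : ℤ) ^ k ∣ i - j := by
  have step : ∀ k, (∀ i j, TrivialExp m (2 * k) i j ↔ (m : ℤ) ^ k ∣ i + j ∧ (m : ℤ) ^ k ∣ i - j) →
      ∀ i j, TrivialExp m (2 * k + 1) i j ↔
        (m : ℤ) ^ (k + 1) ∣ i + j ∧ (m : ℤ) ^ k ∣ i - j := by
    intro k h i j
    rw [trivialExp_succ_iff hm]
    simp only [h]
    constructor
    · rintro ⟨t, ht, ⟨h1, h2⟩, s, -, c, hc⟩
      exact ⟨⟨c, by rw [ht]; linear_combination (m : ℤ) * hc⟩, by simpa [sub_eq_add_neg] using h1⟩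
    · rintro ⟨⟨c, hc⟩, h2⟩
      refine ⟨(m : ℤ) ^ k * c, by rw [hc]; ring, ⟨by simpa [sub_eq_add_neg] using h2, ?_⟩, 0, by simp, by simp⟩
      rw [sub_neg_eq_add, hc, pow_succ, mul_assoc]
      exact Dvd.intro _ rfl
  induction k with
  | zero => exact ⟨by simp [trivialExp_level_zero], step 0 (by simp [trivialExp_level_zero])⟩
  | succ k ih =>
    suffices h : ∀ i j, TrivialExp m (2 * (k + 1)) i j ↔
        (m : ℤ) ^ (k + 1) ∣ i + j ∧ (m : ℤ) ^ (k + 1) ∣ i - j from ⟨h, step _ h⟩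
    intro i j
    rw [show 2 * (k + 1) = 2 * k + 1 + 1 by ring, trivialExp_succ_iff hm]
    simp only [ih.2]
    constructor
    · rintro ⟨t, ht, ⟨h1, h2⟩, s, -, c, hc⟩
      exact ⟨⟨c, by rw [ht]; linear_combination (m : ℤ) * hc⟩, by simpa [sub_eq_add_neg] using h1⟩
    · rintro ⟨⟨c, hc⟩, h2⟩
      obtain ⟨r, hr⟩ := ho
      have hr' : (m : ℤ) = 2 * r + 1 := by exact_mod_cast hr
      -- With m = 2r + 1, this s gives t + 2s = m^{k+1}c; such an s exists because 2 is invertible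
      -- modulo m^{k+1}.
      refine ⟨(m : ℤ) ^ k * c, by rw [hc]; ring, ⟨by simpa [sub_eq_add_neg] using h2, ?_⟩,
        (m : ℤ) ^ k * c * r, ⟨c, ?_⟩, by simp⟩
      · rw [sub_neg_eq_add, hc, pow_succ, mul_assoc]
        exact Dvd.intro _ rfl
      · linear_combination (-(m : ℤ) ^ k * c) * hr'

/-- The sum modulus is now even, so s exists only if t is even; the difference modulus forces this,
and s = -t/2 makes the sum t + 2s vanish. Level 0 does not fit the pattern, so the induction starts
at level 1. -/
theorem trivialExp_iff_of_even {m : ℕ} (hm : 2 ≤ m) (he : Even m) (k : ℕ) :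
    (∀ i j, TrivialExp m (2 * k + 1) i j ↔
        (m : ℤ) ^ (k + 1) ∣ i + j ∧ 2 * (m : ℤ) ^ k ∣ i - j) ∧
      ∀ i j, TrivialExp m (2 * k + 2) i j ↔
        2 * (m : ℤ) ^ (k + 1) ∣ i + j ∧ (m : ℤ) ^ (k + 1) ∣ i - j := by
  obtain ⟨r, hr⟩ := he
  have hr' : (m : ℤ) = 2 * r := by rw [hr]; push_cast; ring
  have step : ∀ k, (∀ i j, TrivialExp m (2 * k + 1) i j ↔
        (m : ℤ) ^ (k + 1) ∣ i + j ∧ 2 * (m : ℤ) ^ k ∣ i - j) →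
      ∀ i j, TrivialExp m (2 * k + 2) i j ↔
        2 * (m : ℤ) ^ (k + 1) ∣ i + j ∧ (m : ℤ) ^ (k + 1) ∣ i - j := by
    intro k h i j
    rw [trivialExp_succ_iff hm]
    simp only [h]
    constructor
    · rintro ⟨t, ht, ⟨h1, h2⟩, s, -, c, hc⟩
      exact ⟨⟨c, by rw [ht]; linear_combination (m : ℤ) * hc⟩, by simpa [sub_eq_add_neg] using h1⟩
    · rintro ⟨⟨c, hc⟩, h2⟩
      refine ⟨2 * (m : ℤ) ^ k * c, by rw [hc]; ring, ⟨by simpa [sub_eq_add_neg] using h2, ?_⟩,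
        -((m : ℤ) ^ k * c), ⟨0, by ring⟩, by simp⟩
      exact ⟨m * c, by rw [sub_neg_eq_add, hc]; ring⟩
  induction k with
  | zero =>
    suffices h : ∀ i j, TrivialExp m (2 * 0 + 1) i j ↔
        (m : ℤ) ^ (0 + 1) ∣ i + j ∧ 2 * (m : ℤ) ^ 0 ∣ i - j from ⟨h, step _ h⟩
    intro i j
    rw [mul_zero, zero_add, trivialExp_one_iff hm, pow_one, pow_zero, mul_one]
    refine ⟨fun h => ⟨h, ?_⟩, fun h => h.1⟩
    obtain ⟨c, hc⟩ := h
    exact ⟨r * c - j, by linear_combination hc + c * hr'⟩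
  | succ k ih =>
    suffices h : ∀ i j, TrivialExp m (2 * (k + 1) + 1) i j ↔
        (m : ℤ) ^ (k + 1 + 1) ∣ i + j ∧ 2 * (m : ℤ) ^ (k + 1) ∣ i - j from ⟨h, step _ h⟩
    intro i j
    rw [show 2 * (k + 1) + 1 = 2 * k + 2 + 1 by ring, trivialExp_succ_iff hm]
    simp only [ih.2]
    constructor
    · rintro ⟨t, ht, ⟨h1, h2⟩, s, -, c, hc⟩
      exact ⟨⟨c, by rw [ht]; linear_combination (m : ℤ) * hc⟩, by simpa [sub_eq_add_neg] using h1⟩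
    · rintro ⟨⟨c, hc⟩, h2⟩
      refine ⟨(m : ℤ) ^ (k + 1) * c, by rw [hc]; ring, ⟨by simpa [sub_eq_add_neg] using h2, ?_⟩,
        -((m : ℤ) ^ k * r * c), ⟨0, ?_⟩, by simp⟩
      · exact ⟨m * c, by rw [sub_neg_eq_add, hc]; ring⟩
      · linear_combination (m : ℤ) ^ k * c * hr'

/-! ### Powers of ab and λ -/

theorem ab_pow_mem_commSt_iff (m n e : ℕ) :
    (a m * b m) ^ e ∈ commSt m n ↔ TrivialExp m n e e := by
  have h := eval_mem_commSt_iff m n ((FreeGroup.of true * FreeGroup.of false) ^ e)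
  simpa [eval_true, eval_false, expSum_pow, expSum_mul, expSum_of] using h

theorem lam_pow_mem_commSt_iff (m n e : ℕ) :
    lam m ^ e ∈ commSt m n ↔ TrivialExp m n e (-e) := by
  have h := eval_mem_commSt_iff m n ((FreeGroup.of true * (FreeGroup.of false)⁻¹) ^ e)
  simpa [eval_true, eval_false, expSum_pow, expSum_mul, expSum_of, expSum_inv, lam] using h

end BSV

theorem mainTheorem3 (m : ℕ) (hm : 2 ≤ m) :
    (Odd m → ∀ k j : ℕ, 1 ≤ j → j ≤ m - 1 →
      (BSV.a m * BSV.b m) ^ (j * m ^ k) ∈ BSV.commSt m (2 * k) \ BSV.commSt m (2 * k + 1) ∧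
      BSV.lam m ^ (j * m ^ k) ∈ BSV.commSt m (2 * k + 1) \ BSV.commSt m (2 * k + 2)) ∧
    (Even m → ∀ k : ℕ,
      (BSV.a m * BSV.b m) ^ (m ^ (k + 1) / 2) ∈
        BSV.commSt m (2 * k + 1) \ BSV.commSt m (2 * k + 2) ∧
      BSV.lam m ^ (m ^ (k + 1) / 2) ∈ BSV.commSt m (2 * k + 2) \ BSV.commSt m (2 * k + 3)) ∧
    (Even m → 4 ≤ m → ∀ k j : ℕ,
      (1 ≤ j ∧ j ≤ m / 2 - 1) ∨ (m / 2 + 1 ≤ j ∧ j ≤ m - 1) →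
      (BSV.a m * BSV.b m) ^ (j * m ^ k) ∈ BSV.commSt m (2 * k) \ BSV.commSt m (2 * k + 1) ∧
      BSV.lam m ^ (j * m ^ k) ∈ BSV.commSt m (2 * k + 1) \ BSV.commSt m (2 * k + 2)) := by
  have hm0 : (m : ℤ) ≠ 0 := by exact_mod_cast (by omega : m ≠ 0)
  have pow_dvd : ∀ k j : ℕ, (m : ℤ) ^ k ∣ (j : ℤ) * m ^ k + j * m ^ k := fun k j =>
    ⟨2 * j, by ring⟩
  have two_pow_dvd : ∀ k j : ℕ, 2 * (m : ℤ) ^ k ∣ (j : ℤ) * m ^ k + j * m ^ k := fun k j =>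
    ⟨j, by ring⟩
  have pow_succ_dvd : ∀ k j : ℕ, (m : ℤ) ^ (k + 1) ∣ (j : ℤ) * m ^ k + j * m ^ k → m ∣ 2 * j := by
    intro k j h
    rw [show (j : ℤ) * m ^ k + j * m ^ k = m ^ k * (2 * j) by ring, pow_succ,
      mul_dvd_mul_iff_left (pow_ne_zero k hm0)] at h
    exact_mod_cast h
  refine ⟨fun ho k j hj1 hj2 => ?_, fun he k => ?_, fun he hm4 k j hj => ?_⟩
  · have hndvd : ¬ m ∣ 2 * j := fun h =>
      absurd (Nat.le_of_dvd (by omega)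
        ((Nat.Coprime.dvd_mul_left (Nat.coprime_two_right.2 ho)).1 h)) (by omega)
    have h1 := BSV.trivialExp_iff_of_odd hm ho k
    have h2 := BSV.trivialExp_iff_of_odd hm ho (k + 1)
    rw [Set.mem_sdiff, Set.mem_sdiff, show 2 * k + 2 = 2 * (k + 1) by ring]
    simp only [BSV.ab_pow_mem_commSt_iff, BSV.lam_pow_mem_commSt_iff, h1.1, h1.2, h2.1]
    push_cast
    simp only [sub_neg_eq_add, add_neg_cancel, sub_self, dvd_zero, and_true, true_and]
    exact ⟨⟨pow_dvd k j, fun h => hndvd (pow_succ_dvd k j h)⟩,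
      pow_dvd k j, fun h => hndvd (pow_succ_dvd k j h)⟩
  · have h1 := BSV.trivialExp_iff_of_even hm he k
    have h2 := BSV.trivialExp_iff_of_even hm he (k + 1)
    have hhalf : ((m ^ (k + 1) / 2 : ℕ) : ℤ) + (m ^ (k + 1) / 2 : ℕ) = (m : ℤ) ^ (k + 1) := by
      have : Even (m ^ (k + 1)) := he.pow_of_ne_zero (by omega)
      have h3 := Nat.div_two_mul_two_of_even this
      have h4 : m ^ (k + 1) / 2 + m ^ (k + 1) / 2 = m ^ (k + 1) := by omega
      exact_mod_cast h4
    have hnot : ¬ 2 * (m : ℤ) ^ (k + 1) ∣ (m : ℤ) ^ (k + 1) := by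
      rintro ⟨c, hc⟩
      have h5 : (m : ℤ) ^ (k + 1) * (1 - 2 * c) = 0 := by linear_combination hc
      rcases mul_eq_zero.1 h5 with h6 | h6
      · exact pow_ne_zero _ hm0 h6
      · omega
    rw [Set.mem_sdiff, Set.mem_sdiff, show 2 * k + 3 = 2 * (k + 1) + 1 by ring]
    simp only [BSV.ab_pow_mem_commSt_iff, BSV.lam_pow_mem_commSt_iff, h1.1, h1.2, h2.1,
      sub_neg_eq_add, add_neg_cancel, sub_self, dvd_zero, and_true, true_and, hhalf]
    exact ⟨⟨dvd_rfl, hnot⟩, dvd_rfl, hnot⟩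
  · have hndvd : ¬ m ∣ 2 * j := by
      rintro ⟨c, hc⟩
      obtain ⟨r, hr⟩ := he
      have hjc : j = r * c := by
        have : 2 * j = 2 * (r * c) := by rw [hc, hr]; ring
        omega
      -- With m = 2r and j = rc: c = 0 gives j = 0, c = 1 gives the excluded j = m/2, and c ≥ 2
      -- gives j ≥ m.
      rcases c with _ | _ | c
      · omega
      · omega
      · have : r * (c + 1 + 1) = r * c + r + r := by ring
        omega
    have h1 := BSV.trivialExp_iff_of_even hm he k
    have h0 : BSV.TrivialExp m (2 * k) ((j * m ^ k : ℕ) : ℤ) ((j * m ^ k : ℕ) : ℤ) := by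
      -- Level 0 is outside the even pattern, so k = 0 is treated separately.
      obtain _ | k := k
      · exact BSV.trivialExp_level_zero _ _ _
      · refine ((BSV.trivialExp_iff_of_even hm he k).2 _ _).2 ⟨?_, by simp⟩
        push_cast
        exact two_pow_dvd _ _
    rw [Set.mem_sdiff, Set.mem_sdiff]
    simp only [BSV.ab_pow_mem_commSt_iff, BSV.lam_pow_mem_commSt_iff, h1.1, h1.2, h0]
    push_cast
    simp only [sub_neg_eq_add, add_neg_cancel, sub_self, dvd_zero, and_true, true_and]
    exact ⟨fun h => hndvd (pow_succ_dvd k j h), two_pow_dvd k j,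
      fun h => hndvd (pow_succ_dvd k j h)⟩
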